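/- **Setting.** Let $\mathcal P=\{\nu_\theta:\theta\in\Theta\}$ be a one-parameter canonical exponential family: $\Theta\subset\mathbb R$ is a non-degenerate interval, $b:\Theta\to\mathbb R$ is strictly convex and twice differentiable (one-sided derivatives at end points that belong to $\Theta$), and $\nu_\theta$ is a probability measure with density $e^{x\theta-b(\theta)}$ with respect to a reference measure $m$ on $\mathbb R$. Let $\mathcal I=\dot b(\Theta)$ be the set of means, and for $\mu\in\mathcal I$ let $\theta_\mu=\dot b^{-1}(\mu)$ and $\nu^\mu=\nu_{\theta_\mu}$. For $\mu\in\mathcal I$ put $d(x,\mu)=\mathrm{KL}(\nu^x,\nu^\mu)$ if $x\in\mathcal I$, and $d(x,\mu)=\sup_{\theta\in\Theta}\{(\theta-\theta_\mu)x-(b(\theta)-b(\theta_\mu))\}\in[0,\infty]$ if $x\notin\mathcal I$. Let $\boldsymbol\mu\in\mathcal I^K$. For $t\ge 1$, an arm $A_t\in\{1,\dots,K\}$ is chosen measurably with respect to $\sigma(\mathcal F_{t-1},U_t)$, where $\mathcal F_{t}=\sigma(A_1,X_1,\dots,A_{t},X_{t})$ and $U_t$ is uniform on $[0,1]$ and independent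 of $\mathcal F_{t-1}$ (the sampling rule); then $X_t$ is observed, with conditional law $\nu^{\mu_{A_t}}$ given $\mathcal F_{t-1}$ and $A_t$. Let $N_a(t)=\sum_{s\le t}\mathbf 1_{(A_s=a)}$ and $S_a(t)=\sum_{s\le t}X_s\mathbf 1_{(A_s=a)}$, and let $\hat\mu_a(t)=S_a(t)/N_a(t)$ if $N_a(t)\ge1$; if $N_a(t)=0$, then $\hat\mu_a(t)$ is an arbitrary fixed real number. Let $h(u)=u-\ln u$ on $[1,\infty)$, with inverse $h^{-1}$ on $[1,\infty)$, and $$\tilde h_z(x)=\begin{cases}e^{1/h^{-1}(x)}\,h^{-1}(x)&\text{if }x\ge h(1/\ln z),\\ z\,(x-\ln\ln z)&\text{otherwise,}\end{cases}\qquad \mathcal T(x)=2\,\tilde h_{3/2}\!\left(\frac{h^{-1}(1+x)+\ln(2\zeta(2))}{2}\right)\quad(x\ge0).$$ For $\delta\in(0,1]$ and $t\in\mathbb N=\{0,1,2,\dots\}$ put $$\hat c_t(\delta)=3\sum_{a:\,N_a(t)\ge1}\ln\bigl(1+\ln N_a(t)\bigr)+K\,\mathcal T\!\left(\frac{\ln(1/\delta)}{K}\right),$$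 $$\mathcal C_t(\delta)=\Bigl\{\boldsymbol\lambda\in\mathcal I^K:\ \sum_{a=1}^K N_a(t)\,d(\hat\mu_a(t),\lambda_a)\le\hat c_t(\delta)\Bigr\}$$ (an arm with $N_a(t)=0$ contributes $0$ to the sum in $\mathcal C_t(\delta)$). **Proposition 5.1.** For every sampling rule, every $\boldsymbol\mu\in\mathcal I^K$ and every $\delta\in(0,1]$, $$\mathbb P_{\boldsymbol\mu}\bigl(\forall t\in\mathbb N,\ \boldsymbol\mu\in\mathcal C_t(\delta)\bigr)\ \ge\ 1-\delta .$$ Moreover, let $\mathcal O_1,\dots,\mathcal O_M\subset\mathcal I^K$ be pairwise disjoint and open in $\mathcal I^K$, with $\boldsymbol\mu\in\mathcal O_{i^*}$. Let $\mathrm{Alt}(\mathbf x)=\bigcup_{i:\mathbf x\notin\mathcal O_i}\mathcal O_i$, let $\hat\imath(t)$ be the index $i$ with $\hat{\boldsymbol\mu}(t)\in\mathcal O_i$ (undefined if there is none), and let $$\hat\Lambda_t=\inf_{\boldsymbol\lambda\in\mathrm{Alt}(\hat{\boldsymbol\mu}(t))}\sum_{a=1}^K N_a(t)\,d(\hat\mu_a(t),\lambda_a),\qquad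 \tau_\delta=\inf\{t\in\mathbb N:\hat\Lambda_t>\hat c_t(\delta)\}$$ (with $\inf\emptyset=\infty$). Then the extended GLR stopping rule $\tau_\delta$ satisfies $$\mathbb P_{\boldsymbol\mu}\bigl(\tau_\delta<\infty,\ \hat\imath(\tau_\delta)\ne i^*\bigr)\ \le\ \delta ,$$ where stopping with $\hat\imath(\tau_\delta)$ undefined also counts as an error. -/

import Mathlib

open MeasureTheory Set

noncomputable section

namespace SeqTest

/-- A one-parameter canonical exponential family: natural parameters `Θ` (an interval), log-partition
function `b`, reference measure `m`; the member `ν_θ` has density `exp (x θ - b θ)` w.r.t. `m`.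
Derivatives are taken within `Θ`, so `Θ` may contain its end points. -/
structure ExpFamily where
  Θ : Set ℝ
  b : ℝ → ℝ
  m : Measure ℝ
  nontrivial : Θ.Nontrivial
  strictConvexOn : StrictConvexOn ℝ Θ b
  differentiableOn : DifferentiableOn ℝ b Θ
  differentiableOn_deriv : DifferentiableOn ℝ (derivWithin b Θ) Θ
  isProbabilityMeasure : ∀ θ ∈ Θ,
    IsProbabilityMeasure (m.withDensity fun x => ENNReal.ofReal (Real.exp (x * θ - b θ)))

namespace ExpFamily

variable (F : ExpFamily)

/-- The member `ν_θ` of natural parameter `θ`. -/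
def member (θ : ℝ) : Measure ℝ :=
  F.m.withDensity fun x => ENNReal.ofReal (Real.exp (x * θ - F.b θ))

/-- The set `I = b'(Θ)` of possible means. -/
def means : Set ℝ := derivWithin F.b F.Θ '' F.Θ

/-- The natural parameter `(b')⁻¹ μ` of the member of mean `μ`, for `μ ∈ I`. -/
def natParam (μ : ℝ) : ℝ := Function.invFunOn (derivWithin F.b F.Θ) F.Θ μ

/-- The member `ν^μ` of mean `μ`, for `μ ∈ I`. -/
def law (μ : ℝ) : Measure ℝ := F.member (F.natParam μ)

open scoped Classical in
/-- The divergence `d(x, μ)` for `μ ∈ I`. For `x ∈ I` it is `KL(ν^x, ν^μ)`. An empirical mean may fall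
outside `I` (for instance `0` or `1` for Bernoulli laws); there `d(x, μ)` is the maximal
log-likelihood ratio per observation
`sup_θ [(θ - θ_μ) x - (b θ - b θ_μ)]`, with `θ_μ` the natural parameter of `ν^μ`
(the term `θ = θ_μ` makes it nonnegative). -/
def d (x μ : ℝ) : ENNReal :=
  if x ∈ F.means then InformationTheory.klDiv (F.law x) (F.law μ)
  else ⨆ θ ∈ F.Θ,
    ENNReal.ofReal ((θ - F.natParam μ) * x - (F.b θ - F.b (F.natParam μ)))

/-- The set `I^K` of possible vectors of means. -/
def meanVectors (K : ℕ) : Set (Fin K → ℝ) := {l | ∀ a, l a ∈ F.means}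

end ExpFamily

section Bandit

variable {K : ℕ} {Ω : Type*}

/-- The σ-algebra generated by the first `t` rounds. Rounds are numbered from `0`:
`A s`, `X s` are the arm and the observation of round `s`. -/
abbrev history (A : ℕ → Ω → Fin K) (X : ℕ → Ω → ℝ) (t : ℕ) : MeasurableSpace Ω :=
  ⨆ s ∈ Finset.range t,
    (MeasurableSpace.comap (A s) inferInstance ⊔ MeasurableSpace.comap (X s) inferInstance)

/-- `(A, X)` are the arms and observations produced by a (possibly randomized) sampling rule in the
bandit model with arms `ν`: `U t` is uniform on `[0,1]` and independent of the past, `A t` is a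
function of the past and `U t`, and, given the past and `A t = a`, `X t` has law `ν a`. -/
structure IsBanditRun [MeasurableSpace Ω] (P : Measure Ω) (ν : Fin K → Measure ℝ)
    (U : ℕ → Ω → ℝ) (A : ℕ → Ω → Fin K) (X : ℕ → Ω → ℝ) : Prop where
  measurable_U : ∀ t, Measurable (U t)
  measurable_A : ∀ t, Measurable (A t)
  measurable_X : ∀ t, Measurable (X t)
  uniform_U : ∀ t, P.map (U t) = volume.restrict (Icc (0 : ℝ) 1)
  indep_U : ∀ t, ProbabilityTheory.Indep
    (MeasurableSpace.comap (U t) inferInstance) (history A X t) P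
  adapted_A : ∀ t,
    Measurable[history A X t ⊔ MeasurableSpace.comap (U t) inferInstance] (A t)
  law_X : ∀ t a (H : Set Ω) (B : Set ℝ), MeasurableSet[history A X t] H → MeasurableSet B →
    P (H ∩ A t ⁻¹' {a} ∩ X t ⁻¹' B) = P (H ∩ A t ⁻¹' {a}) * ν a B

/-- `N_a(t)`: number of selections of arm `a` in the first `t` rounds. -/
def pulls (A : ℕ → Ω → Fin K) (a : Fin K) (t : ℕ) (ω : Ω) : ℕ :=
  ((Finset.range t).filter fun s => A s ω = a).card

/-- `S_a(t)`: sum of the observations from arm `a` in the first `t` rounds. -/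
def total (A : ℕ → Ω → Fin K) (X : ℕ → Ω → ℝ) (a : Fin K) (t : ℕ) (ω : Ω) : ℝ :=
  ∑ s ∈ (Finset.range t).filter (fun s => A s ω = a), X s ω

/-- The vector of empirical means after `t` rounds; an arm `a` that has not been selected yet is given
the conventional value `init a`. -/
def empMean (init : Fin K → ℝ) (A : ℕ → Ω → Fin K) (X : ℕ → Ω → ℝ) (t : ℕ) (ω : Ω) :
    Fin K → ℝ := fun a =>
  if pulls A a t ω = 0 then init a else total A X a t ω / pulls A a t ω

/-- `∑_a N_a(t) d(μ̂_a(t), λ_a)`; arms not selected yet contribute `0`. -/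
def evidence (F : ExpFamily) (init : Fin K → ℝ) (A : ℕ → Ω → Fin K) (X : ℕ → Ω → ℝ)
    (t : ℕ) (ω : Ω) (l : Fin K → ℝ) : ENNReal :=
  ∑ a, (pulls A a t ω : ENNReal) * F.d (empMean init A X t ω a) (l a)

end Bandit

/-- `h u = u - ln u`. -/
def h (u : ℝ) : ℝ := u - Real.log u

/-- The inverse on `[1, ∞)` of `h : [1, ∞) → [1, ∞)`. -/
def hInv (x : ℝ) : ℝ := Function.invFunOn h (Ici 1) x

open scoped Classical in
/-- The function `h̃_z`, for `z ∈ (1, e]`. -/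
def hTilde (z x : ℝ) : ℝ :=
  if h (1 / Real.log z) ≤ x then Real.exp (1 / hInv x) * hInv x
  else z * (x - Real.log (Real.log z))

/-- The threshold function `𝒯`. -/
def threshT (x : ℝ) : ℝ :=
  2 * hTilde (3 / 2) ((hInv (1 + x) + Real.log (2 * (riemannZeta 2).re)) / 2)

section Test

variable {K M : ℕ} {Ω : Type*}

/-- The thresholds `ĉ_t(δ) = 3 ∑_a ln(1 + ln N_a(t)) + K 𝒯(ln(1/δ)/K)`; arms not selected yet
contribute `0` to the sum. -/
def threshold (A : ℕ → Ω → Fin K) (δ : ℝ) (t : ℕ) (ω : Ω) : ℝ :=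
  3 * ∑ a, (if pulls A a t ω = 0 then 0 else Real.log (1 + Real.log (pulls A a t ω)))
    + K * threshT (Real.log (1 / δ) / K)

/-- The confidence region `C_t(δ)`. -/
def region (F : ExpFamily) (init : Fin K → ℝ) (A : ℕ → Ω → Fin K) (X : ℕ → Ω → ℝ)
    (δ : ℝ) (t : ℕ) (ω : Ω) : Set (Fin K → ℝ) :=
  {l | l ∈ F.meanVectors K ∧
    (evidence F init A X t ω l : EReal) ≤ ((threshold A δ t ω : ℝ) : EReal)}

/-- A sequential identification problem: hypotheses `O_1, …, O_M` that are pairwise disjoint, open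
(relatively to `I^K`) sets of possible mean vectors; `O` is their union. -/
structure IsIdentificationProblem (F : ExpFamily) (O : Fin M → Set (Fin K → ℝ)) : Prop where
  isOpen : ∀ i, ∃ V : Set (Fin K → ℝ), IsOpen V ∧ O i = V ∩ F.meanVectors K
  disjoint : ∀ i j, i ≠ j → Disjoint (O i) (O j)

/-- `Alt(x)`: the union of the hypotheses that do not contain `x`. -/
def Alt (O : Fin M → Set (Fin K → ℝ)) (x : Fin K → ℝ) : Set (Fin K → ℝ) :=
  ⋃ i ∈ {i | x ∉ O i}, O i

open scoped Classical in
/-- The index of the hypothesis that contains `x`, or `none` if `x` is in no hypothesis. -/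
def index (O : Fin M → Set (Fin K → ℝ)) (x : Fin K → ℝ) : Option (Fin M) :=
  if hx : ∃ i, x ∈ O i then some hx.choose else none

/-- The extended GLR statistic (an infimum over the empty set is `∞`). -/
def glr (F : ExpFamily) (O : Fin M → Set (Fin K → ℝ)) (init : Fin K → ℝ)
    (A : ℕ → Ω → Fin K) (X : ℕ → Ω → ℝ) (t : ℕ) (ω : Ω) : ENNReal :=
  ⨅ l ∈ Alt O (empMean init A X t ω), evidence F init A X t ω l

/-- The extended GLR stopping rule `τ_δ = inf {t | Λ̂_t > ĉ_t(δ)}`, with value `⊤` if it never stops. -/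
def glrStop (F : ExpFamily) (O : Fin M → Set (Fin K → ℝ)) (init : Fin K → ℝ)
    (A : ℕ → Ω → Fin K) (X : ℕ → Ω → ℝ) (δ : ℝ) (ω : Ω) : ℕ∞ :=
  ⨅ t ∈ {t : ℕ | ((threshold A δ t ω : ℝ) : EReal) < (glr F O init A X t ω : EReal)}, (t : ℕ∞)

end Test

end SeqTest

end

open scoped ENNReal Topology
open Filter

/-! Both claims reduce to one event: at some time the evidence against `μ` exceeds the threshold.
Off this event every region contains `μ`. If the rule stops without recommending `iStar`, then `μ`
lies in `Alt` of the empirical mean, so the GLR statistic is at most the evidence at `μ`.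
`measure_exists_threshold_lt_evidence_le` bounds the event.

For one arm, the divergence is at most a supremum of normalized log-likelihood ratios
(`ExpFamily.d_le_iSup`). For slopes of one sign, the passage of this supremum above a level is
detected by single likelihood ratios, up to a limit (`exists_testFun_of_nonneg`). Mixing over slots
`η^j ≤ n < η^(j+1)` gives a supermartingale that is at least `e^x` when the penalized deviation `G`
is at least `x` (`exists_testFun_stitched`). Mixing over `x`, in the spirit of `e^(rG) = 1 + ∫₀^G r
e^(rx) dx`, gives one that dominates `e^(rG)` and starts at most at `1/(1-r)`
(`exists_testFun_exp_mul`).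

Each round moves only the factor of the sampled arm, so the product over the arms is again a
supermartingale. By `IsBanditRun.ville`, `∑ G_a ≥ K v` ever occurs with probability at most
`(1-r)^(-K) e^(-rKv)`. For `r = 1 - 1/v` this is `e^(-K (h v - 1))`, which equals `δ` when `v = hInv
(1 + ln(1/δ)/K)`. The best `η` turns the level `K v` into the threshold built on `hTilde`. -/

namespace SeqTest

/-! ### Test functions and the operations that preserve them -/

/-- A function `g n s` of the number `n` and the sum `s` of observations that is a nonnegative
supermartingale, of initial value at most `C`, for i.i.d. observations of law `ν`. -/
structure IsTestFun (ν : Measure ℝ) (C : ℝ≥0∞) (g : ℕ → ℝ → ℝ≥0∞) : Prop where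
  measurable : ∀ n, Measurable (g n)
  step : ∀ n s, ∫⁻ x, g (n + 1) (s + x) ∂ν ≤ g n s
  init : g 0 0 ≤ C

namespace IsTestFun

variable {ν : Measure ℝ}

lemma const [IsProbabilityMeasure ν] (c : ℝ≥0∞) : IsTestFun ν c fun _ _ => c where
  measurable _ := measurable_const
  step _ _ := by simp
  init := le_rfl

lemma mono {C C' : ℝ≥0∞} {g : ℕ → ℝ → ℝ≥0∞} (hg : IsTestFun ν C g) (h : C ≤ C') :
    IsTestFun ν C' g where
  measurable := hg.measurable
  step := hg.step
  init := hg.init.trans h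

lemma add {C C' : ℝ≥0∞} {g g' : ℕ → ℝ → ℝ≥0∞} (hg : IsTestFun ν C g)
    (hg' : IsTestFun ν C' g') : IsTestFun ν (C + C') fun n s => g n s + g' n s where
  measurable n := (hg.measurable n).add (hg'.measurable n)
  step n s := by
    have hm : Measurable fun x => g (n + 1) (s + x) :=
      (hg.measurable _).comp (measurable_const_add s)
    rw [lintegral_add_left hm]
    exact add_le_add (hg.step n s) (hg'.step n s)
  init := add_le_add hg.init hg'.init

lemma tsum_mul {C w : ℕ → ℝ≥0∞} {g : ℕ → ℕ → ℝ → ℝ≥0∞} (hg : ∀ j, IsTestFun ν (C j) (g j)) :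
    IsTestFun ν (∑' j, w j * C j) fun n s => ∑' j, w j * g j n s where
  measurable n := Measurable.tsum fun j => ((hg j).measurable n).const_mul _
  step n s := by
    have hm : ∀ j, Measurable fun x => g j (n + 1) (s + x) := fun j =>
      ((hg j).measurable _).comp (measurable_const_add s)
    rw [lintegral_tsum fun j => ((hm j).const_mul _).aemeasurable]
    refine ENNReal.tsum_le_tsum fun j => ?_
    rw [lintegral_const_mul _ (hm j)]
    gcongr
    exact (hg j).step n s
  init := ENNReal.tsum_le_tsum fun j => by gcongr; exact (hg j).init

/-- Fatou's lemma preserves the supermartingale inequality. This allows limits of test functions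
where a supremum or an infimum is not attained. -/
lemma liminf {C : ℝ≥0∞} {g : ℕ → ℕ → ℝ → ℝ≥0∞} (hg : ∀ j, IsTestFun ν C (g j)) :
    IsTestFun ν C fun n s => Filter.liminf (fun j => g j n s) atTop where
  measurable n := Measurable.liminf fun j => (hg j).measurable n
  step n s := by
    refine (lintegral_liminf_le fun j =>
      ((hg j).measurable _).comp (measurable_const_add s)).trans ?_
    exact liminf_le_liminf (Eventually.of_forall fun j => (hg j).step n s)
  init := by
    calc _ ≤ Filter.liminf (fun _ : ℕ => C) atTop :=
          liminf_le_liminf (Eventually.of_forall fun j => (hg j).init)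
      _ = C := by simp

lemma exp_linear {ψ c : ℝ} (h : ∫⁻ x, ENNReal.ofReal (Real.exp (ψ * x - c)) ∂ν ≤ 1) :
    IsTestFun ν 1 fun n s => ENNReal.ofReal (Real.exp (ψ * s - n * c)) where
  measurable n := by fun_prop
  step n s := by
    have h1 : ∀ x : ℝ, ENNReal.ofReal (Real.exp (ψ * (s + x) - ((n + 1 : ℕ) : ℝ) * c))
        = ENNReal.ofReal (Real.exp (ψ * s - n * c)) *
          ENNReal.ofReal (Real.exp (ψ * x - c)) := fun x => by
      rw [← ENNReal.ofReal_mul (Real.exp_pos _).le, ← Real.exp_add]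
      congr 2
      push_cast
      ring
    simp_rw [h1]
    rw [lintegral_const_mul _ (by fun_prop)]
    exact mul_le_of_le_one_right' h
  init := by simp

end IsTestFun

/-! ### Ville's inequality under adaptive sampling -/

section Ville

variable {K : ℕ} {Ω : Type*}

lemma pulls_succ (A : ℕ → Ω → Fin K) (a : Fin K) (t : ℕ) (ω : Ω) :
    pulls A a (t + 1) ω = pulls A a t ω + if A t ω = a then 1 else 0 := by
  unfold pulls
  rw [Finset.range_add_one, Finset.filter_insert]
  split_ifs <;> simp

lemma total_succ (A : ℕ → Ω → Fin K) (X : ℕ → Ω → ℝ) (a : Fin K) (t : ℕ) (ω : Ω) :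
    total A X a (t + 1) ω = total A X a t ω + if A t ω = a then X t ω else 0 := by
  unfold total
  rw [Finset.sum_filter, Finset.sum_range_succ, Finset.sum_filter]

lemma history_mono (A : ℕ → Ω → Fin K) (X : ℕ → Ω → ℝ) : Monotone (history A X) := by
  intro s t hst
  exact biSup_mono fun i hi => Finset.mem_range.2 ((Finset.mem_range.1 hi).trans_le hst)

lemma measurable_history_A (A : ℕ → Ω → Fin K) (X : ℕ → Ω → ℝ) (t : ℕ) :
    Measurable[history A X (t + 1)] (A t) :=
  Measurable.mono (comap_measurable (A t)) (le_trans le_sup_left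
    (le_biSup (fun s => MeasurableSpace.comap (A s) inferInstance ⊔
      MeasurableSpace.comap (X s) inferInstance) (Finset.mem_range.2 t.lt_succ_self))) le_rfl

lemma measurable_history_X (A : ℕ → Ω → Fin K) (X : ℕ → Ω → ℝ) (t : ℕ) :
    Measurable[history A X (t + 1)] (X t) :=
  Measurable.mono (comap_measurable (X t)) (le_trans le_sup_right
    (le_biSup (fun s => MeasurableSpace.comap (A s) inferInstance ⊔
      MeasurableSpace.comap (X s) inferInstance) (Finset.mem_range.2 t.lt_succ_self))) le_rfl

lemma measurable_pulls (A : ℕ → Ω → Fin K) (X : ℕ → Ω → ℝ) (a : Fin K) (t : ℕ) :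
    Measurable[history A X t] (pulls A a t) := by
  induction t with
  | zero =>
    have : pulls A a 0 = fun _ => 0 := by ext ω; simp [pulls]
    rw [this]
    exact @measurable_const _ _ _ (_) _
  | succ t ih =>
    have : pulls A a (t + 1) = fun ω => pulls A a t ω + (if A t ω = a then 1 else 0) := by
      ext ω; exact pulls_succ A a t ω
    rw [this]
    refine @Measurable.add _ _ _ _ _ (_) _ _
      (ih.mono (history_mono A X t.le_succ) le_rfl) ?_
    exact Measurable.comp (g := fun b : Fin K => if b = a then 1 else 0)
      (measurable_of_countable _) (measurable_history_A A X t)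

lemma measurable_total (A : ℕ → Ω → Fin K) (X : ℕ → Ω → ℝ) (a : Fin K) (t : ℕ) :
    Measurable[history A X t] (total A X a t) := by
  induction t with
  | zero =>
    have : total A X a 0 = fun _ => 0 := by ext ω; simp [total]
    rw [this]
    exact @measurable_const _ _ _ (_) _
  | succ t ih =>
    have : total A X a (t + 1) = fun ω => total A X a t ω + (if A t ω = a then X t ω else 0) := by
      ext ω; exact total_succ A X a t ω
    rw [this]
    refine @Measurable.add _ _ _ _ _ (_) _ _
      (ih.mono (history_mono A X t.le_succ) le_rfl) ?_
    refine Measurable.ite ?_ (measurable_history_X A X t) (@measurable_const _ _ _ (_) _)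
    exact measurable_history_A A X t (measurableSet_singleton a)

/-- The number of observations and their sum, for each arm. -/
def stat (A : ℕ → Ω → Fin K) (X : ℕ → Ω → ℝ) (t : ℕ) (ω : Ω) : Fin K → ℕ × ℝ :=
  fun a => (pulls A a t ω, total A X a t ω)

lemma measurable_stat (A : ℕ → Ω → Fin K) (X : ℕ → Ω → ℝ) (t : ℕ) :
    Measurable[history A X t] (stat A X t) := by
  refine @measurable_pi_lambda _ _ _ (_) _ _ fun a => ?_
  exact @Measurable.prodMk _ _ _ _ _ (_) _ _ (measurable_pulls A X a t) (measurable_total A X a t)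

/-- The product over the arms of test functions, as a function of the statistics. -/
noncomputable def prodTestFun (g : Fin K → ℕ → ℝ → ℝ≥0∞) (v : Fin K → ℕ × ℝ) : ℝ≥0∞ :=
  ∏ a, g a (v a).1 (v a).2

lemma measurable_prodTestFun {g : Fin K → ℕ → ℝ → ℝ≥0∞} (hg : ∀ a n, Measurable (g a n)) :
    Measurable (prodTestFun g) := by
  refine Finset.measurable_prod _ fun a _ => ?_
  have : Measurable fun p : ℕ × ℝ => g a p.1 p.2 :=
    measurable_from_prod_countable_right fun n => hg a n
  exact this.comp (measurable_pi_apply a)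

variable [MeasurableSpace Ω] {P : Measure Ω} {ν : Fin K → Measure ℝ}
  {U : ℕ → Ω → ℝ} {A : ℕ → Ω → Fin K} {X : ℕ → Ω → ℝ}

lemma IsBanditRun.history_le (h : IsBanditRun P ν U A X) (t : ℕ) :
    history A X t ≤ (inferInstance : MeasurableSpace Ω) :=
  iSup₂_le fun s _ => sup_le (h.measurable_A s).comap_le (h.measurable_X s).comap_le

variable [IsProbabilityMeasure P]

/-- On a past event where arm `a` is drawn, the new observation is independent of the current
statistics: `law_X` gives the product formula on rectangles, which determines the joint law. -/
lemma IsBanditRun.map_stat_X (h : IsBanditRun P ν U A X) [∀ a, IsProbabilityMeasure (ν a)]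
    (t : ℕ) (a : Fin K) {H : Set Ω} (hH : MeasurableSet[history A X t] H) :
    (P.restrict (H ∩ A t ⁻¹' {a})).map (fun ω => (stat A X t ω, X t ω))
      = ((P.restrict (H ∩ A t ⁻¹' {a})).map (stat A X t)).prod (ν a) := by
  have hst : Measurable (stat A X t) := (measurable_stat A X t).mono (h.history_le t) le_rfl
  have hHA : MeasurableSet (H ∩ A t ⁻¹' {a}) :=
    ((h.history_le t) _ hH).inter (h.measurable_A t (measurableSet_singleton a))
  have : IsFiniteMeasure ((P.restrict (H ∩ A t ⁻¹' {a})).map (stat A X t)) := by infer_instance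
  refine (Measure.prod_eq fun C B hC hB => ?_).symm
  rw [Measure.map_apply (hst.prodMk (h.measurable_X t)) (hC.prod hB),
    Measure.map_apply hst hC, Measure.restrict_apply' hHA, Measure.restrict_apply' hHA]
  have key := h.law_X t a (H ∩ stat A X t ⁻¹' C) B
    (@MeasurableSet.inter _ (_) _ _ hH (measurable_stat A X t hC)) hB
  convert key using 2
  · ext ω
    simp only [mem_inter_iff, mem_preimage, mem_prod, mem_singleton_iff]
    tauto
  · congr 1
    ext ω
    simp only [mem_inter_iff, mem_preimage, mem_singleton_iff]
    tauto

/-- Supermartingale property of the product, integrated over past events. After splitting by the arm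
drawn, only the factor of that arm changes, and its `step` applies under the product law. -/
lemma IsBanditRun.setLIntegral_prodTestFun_succ_le (h : IsBanditRun P ν U A X)
    [∀ a, IsProbabilityMeasure (ν a)] {C : Fin K → ℝ≥0∞} {g : Fin K → ℕ → ℝ → ℝ≥0∞}
    (hg : ∀ a, IsTestFun (ν a) (C a) (g a)) (t : ℕ) {H : Set Ω}
    (hH : MeasurableSet[history A X t] H) :
    ∫⁻ ω in H, prodTestFun g (stat A X (t + 1) ω) ∂P ≤
      ∫⁻ ω in H, prodTestFun g (stat A X t ω) ∂P := by
  have hst : Measurable (stat A X t) := (measurable_stat A X t).mono (h.history_le t) le_rfl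
  have hHm : MeasurableSet H := h.history_le t _ hH
  have hAm : ∀ a, MeasurableSet (A t ⁻¹' {a}) := fun a =>
    h.measurable_A t (measurableSet_singleton a)
  have hsplit : H = ⋃ a, H ∩ A t ⁻¹' {a} := by ext ω; simp
  have hdisj : Pairwise (Function.onFun Disjoint fun a => H ∩ A t ⁻¹' {a}) := by
    intro a b hab
    refine Set.disjoint_left.2 fun ω h1 h2 => hab ?_
    exact h1.2.symm.trans h2.2
  have hpm := measurable_prodTestFun fun a => (hg a).measurable
  rw [hsplit, lintegral_iUnion (fun a => hHm.inter (hAm a)) hdisj,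
    lintegral_iUnion (fun a => hHm.inter (hAm a)) hdisj]
  refine ENNReal.tsum_le_tsum fun a => ?_
  let upd : (Fin K → ℕ × ℝ) × ℝ → (Fin K → ℕ × ℝ) := fun p =>
    Function.update p.1 a ((p.1 a).1 + 1, (p.1 a).2 + p.2)
  have hupd : Measurable upd := by
    refine measurable_pi_lambda _ fun b => ?_
    by_cases hb : b = a
    · subst hb
      simp only [upd, Function.update_self]
      fun_prop
    · simp only [upd, Function.update_of_ne hb]
      fun_prop
  have hupd_prod : ∀ v x, prodTestFun g (upd (v, x)) =
      (∏ b ∈ Finset.univ.erase a, g b (v b).1 (v b).2) * g a ((v a).1 + 1) ((v a).2 + x) := by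
    intro v x
    unfold prodTestFun
    rw [← Finset.prod_erase_mul _ _ (Finset.mem_univ a)]
    congr 1
    · refine Finset.prod_congr rfl fun b hb => ?_
      simp only [upd, Function.update_of_ne (Finset.ne_of_mem_erase hb)]
    · simp [upd]
  calc ∫⁻ ω in H ∩ A t ⁻¹' {a}, prodTestFun g (stat A X (t + 1) ω) ∂P
      = ∫⁻ ω in H ∩ A t ⁻¹' {a}, prodTestFun g (upd (stat A X t ω, X t ω)) ∂P := by
        refine setLIntegral_congr_fun (hHm.inter (hAm a)) fun ω hω => ?_
        have hω' : A t ω = a := hω.2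
        congr 1
        ext b : 1
        by_cases hb : b = a
        · subst hb
          simp [stat, upd, pulls_succ, total_succ, hω']
        · have : a ≠ b := fun e => hb e.symm
          simp [stat, upd, pulls_succ, total_succ, hω', hb, this]
    _ = ∫⁻ v, ∫⁻ x, prodTestFun g (upd (v, x)) ∂(ν a)
          ∂((P.restrict (H ∩ A t ⁻¹' {a})).map (stat A X t)) := by
        rw [← lintegral_map (f := fun p => prodTestFun g (upd p)) (hpm.comp hupd)
          (hst.prodMk (h.measurable_X t)), h.map_stat_X t a hH,
          lintegral_prod (fun p => prodTestFun g (upd p)) (hpm.comp hupd).aemeasurable]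
    _ ≤ ∫⁻ v, prodTestFun g v ∂((P.restrict (H ∩ A t ⁻¹' {a})).map (stat A X t)) := by
        refine lintegral_mono fun v => ?_
        simp_rw [hupd_prod]
        have hm : Measurable fun x => g a ((v a).1 + 1) ((v a).2 + x) :=
          ((hg a).measurable _).comp (measurable_const_add _)
        rw [lintegral_const_mul _ hm]
        unfold prodTestFun
        rw [← Finset.prod_erase_mul _ _ (Finset.mem_univ a)]
        gcongr
        exact (hg a).step _ _
    _ = ∫⁻ ω in H ∩ A t ⁻¹' {a}, prodTestFun g (stat A X t ω) ∂P := lintegral_map hpm hst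

/-- Ville's inequality for a product over the arms of test functions. -/
lemma IsBanditRun.ville (h : IsBanditRun P ν U A X) [∀ a, IsProbabilityMeasure (ν a)]
    {C : Fin K → ℝ≥0∞} {g : Fin K → ℕ → ℝ → ℝ≥0∞}
    (hg : ∀ a, IsTestFun (ν a) (C a) (g a)) (c : ℝ≥0∞) :
    c * P {ω | ∃ t, c ≤ ∏ a, g a (pulls A a t ω) (total A X a t ω)} ≤ ∏ a, C a := by
  set Z : ℕ → Ω → ℝ≥0∞ := fun t ω => prodTestFun g (stat A X t ω) with hZ
  have hpm := measurable_prodTestFun fun a => (hg a).measurable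
  have hZm : ∀ t, Measurable[history A X t] (Z t) := fun t =>
    hpm.comp (measurable_stat A X t)
  have hZm' : ∀ t, Measurable (Z t) := fun t => (hZm t).mono (h.history_le t) le_rfl
  let H : ℕ → Set Ω := fun t => {ω | ∃ s ≤ t, c ≤ Z s ω}
  have hH : ∀ t, MeasurableSet[history A X t] (H t) := by
    intro t
    have : H t = ⋃ s ∈ Iic t, {ω | c ≤ Z s ω} := by ext ω; simp [H]
    rw [this]
    refine @MeasurableSet.biUnion _ _ (_) _ _ (Set.to_countable _) fun s hs => ?_
    exact history_mono A X hs _ (hZm s measurableSet_Ici)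
  have hHm : ∀ t, MeasurableSet (H t) := fun t => h.history_le t _ (hH t)
  have hmono : Monotone H := fun s t hst ω ⟨r, hr, hc⟩ => ⟨r, hr.trans hst, hc⟩
  -- The process stopped at its first passage above `c`: the value is replaced by `c` on `H t`,
  -- while `Z` still runs on the complement.
  have key : ∀ t, c * P (H t) + ∫⁻ ω in (H t)ᶜ, Z t ω ∂P ≤ ∏ a, C a := by
    intro t
    induction t with
    | zero =>
      have h0 : ∀ ω, Z 0 ω ≤ ∏ a, C a := fun ω => by
        refine Finset.prod_le_prod' fun a _ => ?_
        simpa [stat, pulls, total] using (hg a).init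
      calc c * P (H 0) + ∫⁻ ω in (H 0)ᶜ, Z 0 ω ∂P
          ≤ ∫⁻ ω in H 0, Z 0 ω ∂P + ∫⁻ ω in (H 0)ᶜ, Z 0 ω ∂P := by
            gcongr
            rw [← setLIntegral_const]
            refine setLIntegral_mono (hZm' 0) fun ω ⟨s, hs, hc⟩ => ?_
            rwa [Nat.le_zero.1 hs] at hc
        _ = ∫⁻ ω, Z 0 ω ∂P := lintegral_add_compl _ (hHm 0)
        _ ≤ ∫⁻ _, ∏ a, C a ∂P := lintegral_mono h0
        _ = ∏ a, C a := by simp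
    | succ t ih =>
      refine le_trans ?_ ih
      have hcompl : (H t)ᶜ = (H (t + 1) \ H t) ∪ (H (t + 1))ᶜ := by
        ext ω
        have := @hmono t (t + 1) t.le_succ ω
        simp only [mem_compl_iff, mem_union, Set.mem_sdiff]
        tauto
      have hPH : P (H (t + 1)) = P (H t) + P (H (t + 1) \ H t) := by
        rw [← measure_union disjoint_sdiff_right ((hHm _).diff (hHm _)),
          union_sdiff_cancel (hmono t.le_succ)]
      calc c * P (H (t + 1)) + ∫⁻ ω in (H (t + 1))ᶜ, Z (t + 1) ω ∂P
          = c * P (H t) + (c * P (H (t + 1) \ H t)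
              + ∫⁻ ω in (H (t + 1))ᶜ, Z (t + 1) ω ∂P) := by rw [hPH]; ring
        _ ≤ c * P (H t) + (∫⁻ ω in H (t + 1) \ H t, Z (t + 1) ω ∂P
              + ∫⁻ ω in (H (t + 1))ᶜ, Z (t + 1) ω ∂P) := by
            gcongr
            rw [← setLIntegral_const]
            refine setLIntegral_mono (hZm' _) fun ω hω => ?_
            obtain ⟨⟨s, hs, hc⟩, hn⟩ := hω
            have : s = t + 1 := le_antisymm hs (by
              by_contra hlt
              exact hn ⟨s, by omega, hc⟩)
            rwa [this] at hc
        _ = c * P (H t) + ∫⁻ ω in (H t)ᶜ, Z (t + 1) ω ∂P := by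
            rw [hcompl, lintegral_union (hHm _).compl]
            exact Set.disjoint_left.2 fun ω h1 h2 => h2 h1.1
        _ ≤ c * P (H t) + ∫⁻ ω in (H t)ᶜ, Z t ω ∂P := by
            gcongr c * P (H t) + ?_
            exact h.setLIntegral_prodTestFun_succ_le hg t (@MeasurableSet.compl _ _ (_) (hH t))
  have hU : {ω | ∃ t, c ≤ ∏ a, g a (pulls A a t ω) (total A X a t ω)} = ⋃ t, H t := by
    ext ω
    simp only [mem_ofPred_eq, mem_iUnion, H]
    exact ⟨fun ⟨t, ht⟩ => ⟨t, t, le_rfl, ht⟩, fun ⟨_, s, _, hs⟩ => ⟨s, hs⟩⟩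
  rw [hU, hmono.measure_iUnion, ENNReal.mul_iSup]
  exact iSup_le fun t => le_self_add.trans (key t)

end Ville

/-! ### Likelihood ratios and the divergence in an exponential family -/

namespace ExpFamily

variable (F : ExpFamily)

lemma natParam_mem {μ : ℝ} (hμ : μ ∈ F.means) : F.natParam μ ∈ F.Θ :=
  Function.invFunOn_mem hμ

lemma derivWithin_natParam {μ : ℝ} (hμ : μ ∈ F.means) :
    derivWithin F.b F.Θ (F.natParam μ) = μ :=
  Function.invFunOn_eq hμ

lemma isProbabilityMeasure_member {θ : ℝ} (hθ : θ ∈ F.Θ) : IsProbabilityMeasure (F.member θ) :=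
  F.isProbabilityMeasure θ hθ

lemma isProbabilityMeasure_law {μ : ℝ} (hμ : μ ∈ F.means) : IsProbabilityMeasure (F.law μ) :=
  F.isProbabilityMeasure_member (F.natParam_mem hμ)

lemma member_eq_withDensity (θ₀ θ : ℝ) :
    F.member θ = (F.member θ₀).withDensity fun x =>
      ENNReal.ofReal (Real.exp ((θ - θ₀) * x - (F.b θ - F.b θ₀))) := by
  unfold member
  rw [← withDensity_mul _ (by fun_prop) (by fun_prop)]
  congr 1
  ext x
  rw [Pi.mul_apply, ← ENNReal.ofReal_mul (Real.exp_pos _).le, ← Real.exp_add]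
  congr 2
  ring

lemma lintegral_likelihoodRatio (θ₀ : ℝ) {θ : ℝ} (hθ : θ ∈ F.Θ) :
    ∫⁻ x, ENNReal.ofReal (Real.exp ((θ - θ₀) * x - (F.b θ - F.b θ₀))) ∂(F.member θ₀) = 1 := by
  have := (F.isProbabilityMeasure_member hθ).measure_univ
  rw [F.member_eq_withDensity θ₀ θ, withDensity_apply _ MeasurableSet.univ] at this
  simpa using this

lemma lintegral_exp_mul (θ₀ : ℝ) {θ : ℝ} (hθ : θ ∈ F.Θ) :
    ∫⁻ x, ENNReal.ofReal (Real.exp ((θ - θ₀) * x)) ∂(F.member θ₀) =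
      ENNReal.ofReal (Real.exp (F.b θ - F.b θ₀)) := by
  have h := F.lintegral_likelihoodRatio θ₀ hθ
  have h1 : ∀ x : ℝ, ENNReal.ofReal (Real.exp ((θ - θ₀) * x)) =
      ENNReal.ofReal (Real.exp (F.b θ - F.b θ₀)) *
        ENNReal.ofReal (Real.exp ((θ - θ₀) * x - (F.b θ - F.b θ₀))) := fun x => by
    rw [← ENNReal.ofReal_mul (Real.exp_pos _).le, ← Real.exp_add]
    congr 2
    ring
  simp_rw [h1]
  rw [lintegral_const_mul _ (by fun_prop), h, mul_one]

lemma integrable_exp_mul (θ₀ : ℝ) {θ : ℝ} (hθ : θ ∈ F.Θ) :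
    Integrable (fun x => Real.exp ((θ - θ₀) * x)) (F.member θ₀) := by
  refine ⟨by fun_prop, ?_⟩
  rw [hasFiniteIntegral_iff_ofReal (ae_of_all _ fun x => (Real.exp_pos _).le),
    F.lintegral_exp_mul θ₀ hθ]
  exact ENNReal.ofReal_lt_top

lemma integral_exp_mul (θ₀ : ℝ) {θ : ℝ} (hθ : θ ∈ F.Θ) :
    ∫ x, Real.exp ((θ - θ₀) * x) ∂(F.member θ₀) = Real.exp (F.b θ - F.b θ₀) := by
  rw [integral_eq_lintegral_of_nonneg_ae (ae_of_all _ fun x => (Real.exp_pos _).le) (by fun_prop),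
    F.lintegral_exp_mul θ₀ hθ, ENNReal.toReal_ofReal (Real.exp_pos _).le]

/-- In any direction inside `Θ`, the mean of a member is integrable and is at least the derivative
of the log-partition function; the parameter may be an end point of `Θ`. -/
lemma integrable_and_le_integral {θ₀ θ : ℝ} (h₀ : θ₀ ∈ F.Θ) (hθ : θ ∈ F.Θ) :
    Integrable (fun x => (θ - θ₀) * x) (F.member θ₀) ∧
      (θ - θ₀) * derivWithin F.b F.Θ θ₀ ≤ ∫ x, (θ - θ₀) * x ∂(F.member θ₀) := by
  have := F.isProbabilityMeasure_member h₀
  set w := θ - θ₀ with hw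
  set ρ := F.member θ₀
  let ε : ℕ → ℝ := fun n => 1 / ((n : ℝ) + 1)
  have hε0 : ∀ n, 0 < ε n := fun n => by positivity
  have hε1 : ∀ n, ε n ≤ 1 := fun n => by
    simp only [ε]
    rw [div_le_one (by positivity)]
    linarith [(Nat.cast_nonneg n : (0 : ℝ) ≤ n)]
  have hεlim : Tendsto ε atTop (𝓝 0) := tendsto_one_div_add_atTop_nhds_zero_nat
  have hmem : ∀ e ∈ Icc (0 : ℝ) 1, θ₀ + e * w ∈ F.Θ := fun e he => by
    have := F.strictConvexOn.1.add_smul_sub_mem h₀ hθ he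
    simpa using this
  -- the difference quotients of `e ↦ exp (e w x)`
  let q : ℕ → ℝ → ℝ := fun n x => (Real.exp (ε n * (w * x)) - 1) / ε n
  have hq_le : ∀ n x, q n x ≤ Real.exp (w * x) - 1 := fun n x => by
    simp only [q]
    rw [div_le_iff₀ (hε0 n)]
    have hc := convexOn_exp.2 (mem_univ (w * x)) (mem_univ (0 : ℝ)) (hε0 n).le
      (sub_nonneg.2 (hε1 n)) (by ring)
    simp only [smul_eq_mul, mul_zero, add_zero, Real.exp_zero, mul_one] at hc
    linarith
  have hq_lim : ∀ x, Tendsto (fun n => q n x) atTop (𝓝 (w * x)) := fun x => by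
    have hd : HasDerivAt (fun e : ℝ => Real.exp (e * (w * x))) (w * x) 0 := by
      have := ((hasDerivAt_id (0 : ℝ)).mul_const (w * x)).exp
      simpa using this
    have hs := hd.tendsto_slope.comp (tendsto_nhdsWithin_iff.2
      ⟨hεlim, Eventually.of_forall fun n => (hε0 n).ne'⟩)
    refine hs.congr fun n => ?_
    simp [slope_def_field, q]
  have hqint : ∀ n, Integrable (q n) ρ ∧
      ∫ x, q n x ∂ρ = (Real.exp (F.b (θ₀ + ε n * w) - F.b θ₀) - 1) / ε n := fun n => by
    have hm := hmem (ε n) ⟨(hε0 n).le, hε1 n⟩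
    have hi := F.integrable_exp_mul θ₀ hm
    have he := F.integral_exp_mul θ₀ hm
    have hr : ∀ x, (θ₀ + ε n * w - θ₀) * x = ε n * (w * x) := fun x => by ring
    simp_rw [hr] at hi he
    refine ⟨(hi.sub (integrable_const 1)).div_const _, ?_⟩
    simp only [q]
    rw [integral_div, integral_sub hi (integrable_const 1), he]
    simp
  have hilim : Tendsto (fun n => ∫ x, q n x ∂ρ) atTop (𝓝 (w * derivWithin F.b F.Θ θ₀)) := by
    have hb : HasDerivWithinAt F.b (derivWithin F.b F.Θ θ₀) F.Θ (θ₀ + 0 * w) := by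
      simpa using (F.differentiableOn θ₀ h₀).hasDerivWithinAt
    have hl : HasDerivWithinAt (fun e : ℝ => θ₀ + e * w) w (Icc 0 1) 0 := by
      have := ((hasDerivAt_id (0 : ℝ)).mul_const w).const_add θ₀
      simpa using this.hasDerivWithinAt
    have hd := ((hb.comp 0 hl hmem).sub_const (F.b θ₀)).exp
    rw [hasDerivWithinAt_iff_tendsto_slope] at hd
    have hs := hd.comp (tendsto_nhdsWithin_iff.2 ⟨hεlim, Eventually.of_forall fun n =>
      (⟨⟨(hε0 n).le, hε1 n⟩, (hε0 n).ne'⟩ : ε n ∈ Icc (0 : ℝ) 1 \ {0})⟩)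
    have he : w * derivWithin F.b F.Θ θ₀ =
        Real.exp ((F.b ∘ fun e : ℝ => θ₀ + e * w) 0 - F.b θ₀) *
          (derivWithin F.b F.Θ θ₀ * w) := by
      simp [mul_comm]
    rw [he]
    refine hs.congr fun n => ?_
    rw [(hqint n).2]
    simp [slope_def_field]
  have hwint : Integrable (fun x => Real.exp (w * x)) ρ := F.integrable_exp_mul θ₀ hθ
  -- Fatou for `exp (w x) - q n x`, nonnegative by convexity of `exp`. It yields both the
  -- integrability of `w x` and the inequality for its mean.
  have hfatou : ∫⁻ x, ENNReal.ofReal (Real.exp (w * x) - w * x) ∂ρ ≤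
      ENNReal.ofReal (∫ x, Real.exp (w * x) ∂ρ - w * derivWithin F.b F.Θ θ₀) := by
    have h1 : ∀ x, ENNReal.ofReal (Real.exp (w * x) - w * x) =
        liminf (fun n => ENNReal.ofReal (Real.exp (w * x) - q n x)) atTop := fun x =>
      (Tendsto.liminf_eq (ENNReal.tendsto_ofReal ((hq_lim x).const_sub _))).symm
    simp_rw [h1]
    refine (lintegral_liminf_le fun n => by fun_prop).trans ?_
    have h2 : ∀ n, ∫⁻ x, ENNReal.ofReal (Real.exp (w * x) - q n x) ∂ρ =
        ENNReal.ofReal (∫ x, Real.exp (w * x) ∂ρ - ∫ x, q n x ∂ρ) := fun n => by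
      rw [← integral_sub hwint (hqint n).1,
        ofReal_integral_eq_lintegral_ofReal (f := fun x => Real.exp (w * x) - q n x)
          (hwint.sub (hqint n).1) (ae_of_all _ fun x => by
            have := hq_le n x
            simp only [Pi.zero_apply]
            linarith)]
    simp_rw [h2]
    exact (Tendsto.liminf_eq (ENNReal.tendsto_ofReal (hilim.const_sub _))).le
  have hnn : ∀ x, 0 ≤ Real.exp (w * x) - w * x := fun x => by
    linarith [Real.add_one_le_exp (w * x)]
  have hdint : Integrable (fun x => Real.exp (w * x) - w * x) ρ := by
    refine ⟨by fun_prop, ?_⟩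
    rw [hasFiniteIntegral_iff_ofReal (ae_of_all _ hnn)]
    exact hfatou.trans_lt ENNReal.ofReal_lt_top
  have hint : Integrable (fun x => w * x) ρ := by
    have := hwint.sub hdint
    refine this.congr (ae_of_all _ fun x => ?_)
    simp
  refine ⟨hint, ?_⟩
  rw [← ofReal_integral_eq_lintegral_ofReal hdint (ae_of_all _ hnn),
    integral_sub hwint hint] at hfatou
  -- Positivity of the left side of `hfatou`, without which the truncation in `ENNReal.ofReal` would
  -- lose the inequality.
  have hpos : 0 < ∫ x, Real.exp (w * x) ∂ρ - ∫ x, w * x ∂ρ := by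
    have h1 : ∫ x, ((1 : ℝ) + w * x) ∂ρ ≤ ∫ x, Real.exp (w * x) ∂ρ :=
      integral_mono ((integrable_const 1).add hint) hwint fun x => by
        linarith [Real.add_one_le_exp (w * x)]
    rw [integral_add (integrable_const 1) hint] at h1
    simp at h1
    linarith
  have := (ENNReal.ofReal_le_ofReal_iff' ).1 hfatou
  rcases this with h | h <;> linarith

/-- The log-likelihood ratio is affine in the observation, so the divergence depends only on the
mean of `ν^x`. The one-sided bound on this mean, in the direction from `natParam x` to `natParam μ`,
has the right sign, also at end points of `Θ`. -/
lemma klDiv_law_le {x μ : ℝ} (hx : x ∈ F.means) (hμ : μ ∈ F.means) :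
    InformationTheory.klDiv (F.law x) (F.law μ) ≤
      ENNReal.ofReal ((F.natParam x - F.natParam μ) * x -
        (F.b (F.natParam x) - F.b (F.natParam μ))) := by
  set θ := F.natParam x
  set θ₁ := F.natParam μ
  have hθ : θ ∈ F.Θ := F.natParam_mem hx
  have hθ₁ : θ₁ ∈ F.Θ := F.natParam_mem hμ
  have := F.isProbabilityMeasure_member hθ
  have := F.isProbabilityMeasure_member hθ₁
  obtain ⟨hint, hle⟩ := F.integrable_and_le_integral hθ hθ₁
  rw [F.derivWithin_natParam hx] at hle
  have hac : F.member θ ≪ F.member θ₁ := by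
    rw [F.member_eq_withDensity θ₁ θ]
    exact withDensity_absolutelyContinuous _ _
  have hllr : llr (F.member θ) (F.member θ₁) =ᵐ[F.member θ]
      fun y => -((θ₁ - θ) * y) - (F.b θ - F.b θ₁) := by
    have h1 : (F.member θ).rnDeriv (F.member θ₁) =ᵐ[F.member θ₁]
        fun y => ENNReal.ofReal (Real.exp ((θ - θ₁) * y - (F.b θ - F.b θ₁))) := by
      conv_lhs => rw [F.member_eq_withDensity θ₁ θ]
      exact Measure.rnDeriv_withDensity _ (by fun_prop)
    filter_upwards [hac.ae_le h1] with y hy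
    rw [llr, hy, ENNReal.toReal_ofReal (Real.exp_pos _).le, Real.log_exp]
    ring
  have hllr_int : Integrable (llr (F.member θ) (F.member θ₁)) (F.member θ) :=
    (hint.neg.sub (integrable_const _)).congr hllr.symm
  unfold law
  rw [InformationTheory.klDiv_of_ac_of_integrable hac hllr_int]
  refine ENNReal.ofReal_le_ofReal ?_
  rw [integral_congr_ae hllr, integral_sub (f := fun y => -((θ₁ - θ) * y)) hint.neg
    (integrable_const _), integral_neg]
  simp only [integral_const, probReal_univ, smul_eq_mul]
  linarith

lemma d_le_iSup {μ : ℝ} (x : ℝ) (hμ : μ ∈ F.means) :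
    F.d x μ ≤ ⨆ θ ∈ F.Θ,
      ENNReal.ofReal ((θ - F.natParam μ) * x - (F.b θ - F.b (F.natParam μ))) := by
  unfold d
  split_ifs with hx
  · exact (F.klDiv_law_le hx hμ).trans
      (le_iSup₂ (f := fun θ (_ : θ ∈ F.Θ) =>
        ENNReal.ofReal ((θ - F.natParam μ) * x - (F.b θ - F.b (F.natParam μ)))) _
        (F.natParam_mem hx))
  · exact le_rfl

end ExpFamily

/-! ### Detecting the level sets of a supremum of likelihood ratios -/

/-- A set of reals has a sequence that is eventually below each of its elements. -/
lemma exists_seq_eventually_le {E : Set ℝ} (hE : E.Nonempty) :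
    ∃ u : ℕ → ℝ, (∀ k, u k ∈ E) ∧ ∀ x ∈ E, ∀ᶠ k in atTop, u k ≤ x := by
  by_cases hb : BddBelow E
  · by_cases hm : sInf E ∈ E
    · exact ⟨fun _ => sInf E, fun _ => hm, fun x hx => Eventually.of_forall fun _ => csInf_le hb hx⟩
    · obtain ⟨u, -, -, hlim, hu⟩ := (isGLB_csInf hE hb).exists_seq_antitone_tendsto hE
      refine ⟨u, hu, fun x hx => ?_⟩
      have hlt : sInf E < x := lt_of_le_of_ne (csInf_le hb hx) fun e => hm (e ▸ hx)
      exact (hlim.eventually (gt_mem_nhds hlt)).mono fun k hk => hk.le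
  · rw [not_bddBelow_iff] at hb
    choose u hu hlt using fun k : ℕ => hb (-(k : ℝ))
    refine ⟨u, hu, fun x _ => ?_⟩
    filter_upwards [eventually_ge_atTop ⌈-x⌉₊] with k hk
    have := Nat.ceil_le.1 hk
    linarith [hlt k]

/-- A single test function that is large whenever some likelihood ratio in the family `T` of
log-likelihood ratios `ψ s - n c`, with slopes `ψ ≥ 0`, is at least `n L`. -/
lemma exists_testFun_of_nonneg {ν : Measure ℝ} {T : Set (ℝ × ℝ)} (hT : ∀ p ∈ T, 0 ≤ p.1)
    (hν : ∀ p ∈ T, ∫⁻ x, ENNReal.ofReal (Real.exp (p.1 * x - p.2)) ∂ν ≤ 1) {L : ℝ} (hL : 0 < L) :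
    ∃ g, IsTestFun ν 1 g ∧ ∀ (n : ℕ) (s : ℝ), n ≠ 0 →
      ENNReal.ofReal L ≤ ⨆ p ∈ T, ENNReal.ofReal (p.1 * (s / n) - p.2) →
      ENNReal.ofReal (Real.exp (n * L)) ≤ g n s := by
  set E : Set ℝ := {x | ENNReal.ofReal L ≤ ⨆ p ∈ T, ENNReal.ofReal (p.1 * x - p.2)} with hEdef
  rcases E.eq_empty_or_nonempty with hE | hE
  · refine ⟨fun _ _ => 0, ⟨fun _ => measurable_const, fun _ _ => by simp, by simp⟩, ?_⟩
    intro n s _ hs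
    have : s / n ∈ E := hs
    simp [hE] at this
  obtain ⟨u, hu, hule⟩ := exists_seq_eventually_le hE
  -- Levels strictly below `L`, since the supremum over `T` need not be attained. A ratio above `r
  -- k` at `u k` stays above it to the right of `u k`, its slope being nonnegative.
  let r : ℕ → ℝ := fun k => L * (1 - 1 / ((k : ℝ) + 1))
  have hr : ∀ k, r k < L := fun k => by
    have : 0 < 1 / ((k : ℝ) + 1) := by positivity
    simp only [r]
    nlinarith
  have hrlim : Tendsto r atTop (𝓝 L) := by
    have := (tendsto_one_div_add_atTop_nhds_zero_nat (𝕜 := ℝ)).const_sub 1 |>.const_mul L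
    simpa [r] using this
  have hex : ∀ k, ∃ p ∈ T, r k < p.1 * u k - p.2 := fun k => by
    have h1 : ENNReal.ofReal (r k) < ⨆ p ∈ T, ENNReal.ofReal (p.1 * u k - p.2) :=
      ((ENNReal.ofReal_lt_ofReal_iff hL).2 (hr k)).trans_le (hu k)
    simp only [lt_iSup_iff] at h1
    obtain ⟨p, hp, h2⟩ := h1
    exact ⟨p, hp, (ENNReal.ofReal_lt_ofReal_iff').1 h2 |>.1⟩
  choose p hp hlt using hex
  refine ⟨_, IsTestFun.liminf fun k => IsTestFun.exp_linear (hν (p k) (hp k)), ?_⟩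
  intro n s hn hs
  have hn0 : (0 : ℝ) < n := by positivity
  have hlim : Tendsto (fun k => ENNReal.ofReal (Real.exp (n * r k))) atTop
      (𝓝 (ENNReal.ofReal (Real.exp (n * L)))) :=
    ENNReal.tendsto_ofReal ((Real.continuous_exp.tendsto _).comp (hrlim.const_mul _))
  rw [← hlim.liminf_eq]
  refine liminf_le_liminf ?_
  filter_upwards [hule (s / n) hs] with k hk
  refine ENNReal.ofReal_le_ofReal (Real.exp_le_exp.2 ?_)
  have h1 : r k ≤ (p k).1 * (s / n) - (p k).2 :=
    (hlt k).le.trans (by linarith [mul_le_mul_of_nonneg_left hk (hT _ (hp k))])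
  calc n * r k ≤ n * ((p k).1 * (s / n) - (p k).2) := by gcongr
    _ = (p k).1 * s - n * (p k).2 := by field_simp

/-- Reflection `x ↦ -x` of the case of nonnegative slopes. -/
lemma exists_testFun_of_nonpos {ν : Measure ℝ} {T : Set (ℝ × ℝ)} (hT : ∀ p ∈ T, p.1 ≤ 0)
    (hν : ∀ p ∈ T, ∫⁻ x, ENNReal.ofReal (Real.exp (p.1 * x - p.2)) ∂ν ≤ 1) {L : ℝ} (hL : 0 < L) :
    ∃ g, IsTestFun ν 1 g ∧ ∀ (n : ℕ) (s : ℝ), n ≠ 0 →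
      ENNReal.ofReal L ≤ ⨆ p ∈ T, ENNReal.ofReal (p.1 * (s / n) - p.2) →
      ENNReal.ofReal (Real.exp (n * L)) ≤ g n s := by
  obtain ⟨g, hg, hgL⟩ := exists_testFun_of_nonneg (ν := ν.map Neg.neg)
    (T := {p | (-p.1, p.2) ∈ T}) (fun p hp => by simpa using hT _ hp)
    (fun p hp => by
      rw [lintegral_map (by fun_prop) measurable_neg]
      simpa using hν _ hp) hL
  refine ⟨fun n s => g n (-s), ⟨fun n => (hg.measurable n).comp measurable_neg, fun n s => ?_,
    by simpa using hg.init⟩, fun n s hn hs => hgL n (-s) hn (hs.trans ?_)⟩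
  · have := hg.step n (-s)
    have hm : Measurable fun x => g (n + 1) (-s + x) :=
      (hg.measurable _).comp (measurable_const_add _)
    rw [lintegral_map hm measurable_neg] at this
    simpa only [neg_add] using this
  · refine iSup₂_le fun p hp => ?_
    refine le_iSup₂_of_le (-p.1, p.2) (by simpa using hp) (ENNReal.ofReal_le_ofReal (le_of_eq ?_))
    ring

/-- The same without condition on the slopes, at the price of a factor `2`. -/
lemma exists_testFun_iSup {ν : Measure ℝ} {T : Set (ℝ × ℝ)}
    (hν : ∀ p ∈ T, ∫⁻ x, ENNReal.ofReal (Real.exp (p.1 * x - p.2)) ∂ν ≤ 1) {L : ℝ} (hL : 0 < L) :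
    ∃ g, IsTestFun ν 2 g ∧ ∀ (n : ℕ) (s : ℝ), n ≠ 0 →
      ENNReal.ofReal L ≤ ⨆ p ∈ T, ENNReal.ofReal (p.1 * (s / n) - p.2) →
      ENNReal.ofReal (Real.exp (n * L)) ≤ g n s := by
  obtain ⟨g, hg, hgL⟩ := exists_testFun_of_nonneg (ν := ν) (T := {p ∈ T | 0 ≤ p.1})
    (fun p hp => hp.2) (fun p hp => hν p hp.1) hL
  obtain ⟨g', hg', hgL'⟩ := exists_testFun_of_nonpos (ν := ν) (T := {p ∈ T | p.1 ≤ 0})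
    (fun p hp => hp.2) (fun p hp => hν p hp.1) hL
  refine ⟨_, (hg.add hg').mono one_add_one_eq_two.le, fun n s hn hs => ?_⟩
  have hle : ⨆ p ∈ T, ENNReal.ofReal (p.1 * (s / n) - p.2) ≤
      (⨆ p ∈ {p ∈ T | 0 ≤ p.1}, ENNReal.ofReal (p.1 * (s / n) - p.2)) ⊔
        ⨆ p ∈ {p ∈ T | p.1 ≤ 0}, ENNReal.ofReal (p.1 * (s / n) - p.2) := by
    refine iSup₂_le fun p hp => ?_
    rcases le_total 0 p.1 with h | h
    · exact le_sup_of_le_left (le_iSup₂_of_le (f := fun (p : ℝ × ℝ)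
        (_ : p ∈ {p ∈ T | 0 ≤ p.1}) => ENNReal.ofReal (p.1 * (s / n) - p.2)) p ⟨hp, h⟩ le_rfl)
    · exact le_sup_of_le_right (le_iSup₂_of_le (f := fun (p : ℝ × ℝ)
        (_ : p ∈ {p ∈ T | p.1 ≤ 0}) => ENNReal.ofReal (p.1 * (s / n) - p.2)) p ⟨hp, h⟩ le_rfl)
  rcases le_sup_iff.1 (hs.trans hle) with h | h
  · exact (hgL n s hn h).trans le_self_add
  · exact (hgL' n s hn h).trans le_add_self

/-! ### Stitching over geometric slots -/

lemma hasSum_one_div_succ_sq :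
    HasSum (fun j : ℕ => 1 / ((j : ℝ) + 1) ^ 2) (riemannZeta 2).re := by
  have h : (riemannZeta 2).re = Real.pi ^ 2 / 6 := by
    rw [riemannZeta_two]
    norm_cast
  have := (hasSum_nat_add_iff' (f := fun n : ℕ => 1 / (n : ℝ) ^ 2) 1).2 hasSum_zeta_two
  simpa [h] using this

lemma one_le_zeta_two : 1 ≤ (riemannZeta 2).re := by
  have := hasSum_one_div_succ_sq.summable.le_tsum (i := 0) fun j _ => by positivity
  rw [hasSum_one_div_succ_sq.tsum_eq] at this
  simpa using this

lemma log_two_mul_zeta_two_pos : 0 < Real.log (2 * (riemannZeta 2).re) :=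
  Real.log_pos (by linarith [one_le_zeta_two])

/-- A test function that is at least `e ^ x` whenever the divergence, penalized by
`3 ln (1 + ln n)`, exceeds its level at `x`: geometric slots of ratio `η`. -/
lemma exists_testFun_stitched {ν : Measure ℝ} {T : Set (ℝ × ℝ)}
    (hν : ∀ p ∈ T, ∫⁻ x, ENNReal.ofReal (Real.exp (p.1 * x - p.2)) ∂ν ≤ 1)
    {η : ℝ} (hη : 1 < η) (hη' : η ≤ 3 / 2) {x : ℝ} (hx : 0 ≤ x) :
    ∃ g, IsTestFun ν 1 g ∧ ∀ (n : ℕ) (s y : ℝ), n ≠ 0 →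
      ENNReal.ofReal y ≤ n * ⨆ p ∈ T, ENNReal.ofReal (p.1 * (s / n) - p.2) →
      x ≤ (y - 3 * Real.log (1 + Real.log n)) / η - Real.log (2 * (riemannZeta 2).re)
        + 2 * Real.log (Real.log η) →
      ENNReal.ofReal (Real.exp x) ≤ g n s := by
  set ζ := (riemannZeta 2).re with hζdef
  have hζ : 1 ≤ ζ := one_le_zeta_two
  set c := Real.log (2 * ζ)
  have hc : 0 < c := log_two_mul_zeta_two_pos
  have hη0 : 0 < η := by linarith
  -- The terms added to `x` are minus the logarithm of the weight `w j` below, so that `w j * exp (l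
  -- j) = exp x`. The `2` in the weight pays for the two signs of slope.
  let l : ℕ → ℝ := fun j => x + c + 2 * Real.log ((j : ℝ) + 1)
  have hl : ∀ j, 0 < l j := fun j => by
    have : 0 ≤ Real.log ((j : ℝ) + 1) := Real.log_nonneg (by linarith [(j.cast_nonneg : (0:ℝ) ≤ j)])
    simp only [l]
    linarith
  have hLpos : ∀ j, 0 < l j / η ^ j := fun j => div_pos (hl j) (by positivity)
  choose g hg hgL using fun j => exists_testFun_iSup hν (hLpos j)
  let w : ℕ → ℝ≥0∞ := fun j => ENNReal.ofReal (1 / (2 * ζ) * (1 / ((j : ℝ) + 1) ^ 2))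
  have hw : ∑' j, w j * 2 ≤ 1 := by
    rw [ENNReal.tsum_mul_right]
    have hs := hasSum_one_div_succ_sq.mul_left (1 / (2 * ζ))
    rw [← ENNReal.ofReal_tsum_of_nonneg (fun j => by positivity) hs.summable, hs.tsum_eq,
      ← hζdef, show (2 : ℝ≥0∞) = ENNReal.ofReal 2 by simp, ← ENNReal.ofReal_mul (by positivity)]
    refine le_of_eq ?_
    rw [show 1 / (2 * ζ) * ζ * 2 = 1 by field_simp, ENNReal.ofReal_one]
  refine ⟨_, (IsTestFun.tsum_mul (w := w) hg).mono hw, fun n s y hn hy hxy => ?_⟩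
  have hn1 : (1 : ℝ) ≤ n := by exact_mod_cast Nat.one_le_iff_ne_zero.2 hn
  obtain ⟨j, hj, hj'⟩ := exists_nat_pow_near hn1 hη
  have hlogη : 0 < Real.log η := Real.log_pos hη
  have hlogη1 : Real.log η ≤ 1 := by linarith [Real.log_le_sub_one_of_pos hη0]
  have hlogn : 0 ≤ Real.log n := Real.log_nonneg hn1
  have hjlog : j * Real.log η ≤ Real.log n := by
    rw [← Real.log_pow]
    exact Real.log_le_log (by positivity) hj
  have hlogj : Real.log ((j : ℝ) + 1) ≤ Real.log (1 + Real.log n) - Real.log (Real.log η) := by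
    rw [← Real.log_div (by positivity) hlogη.ne']
    refine Real.log_le_log (by positivity) ?_
    rw [le_div_iff₀ hlogη]
    nlinarith
  -- The union over slots costs `2 ln (1 + ln n)`; dividing by `η ≤ 3/2` explains the constant `3`
  -- in the threshold.
  have hpen : 2 * Real.log (1 + Real.log n) ≤ 3 * Real.log (1 + Real.log n) / η := by
    rw [le_div_iff₀ hη0]
    have : 0 ≤ Real.log (1 + Real.log n) := Real.log_nonneg (by linarith)
    nlinarith
  have hly : l j ≤ y / η := by
    rw [sub_div] at hxy
    simp only [l]
    linarith
  -- Since `n < η^(j+1)`, the factor `η` lost in `hly` covers the whole width of the slot.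
  have hlevel : ENNReal.ofReal (l j / η ^ j) ≤
      ⨆ p ∈ T, ENNReal.ofReal (p.1 * (s / n) - p.2) := by
    have hn' : (n : ℝ≥0∞) ≠ 0 := by exact_mod_cast hn
    rw [mul_comm, ← ENNReal.div_le_iff_le_mul (Or.inl hn') (Or.inl (ENNReal.natCast_ne_top n))] at hy
    refine le_trans ?_ hy
    rw [← ENNReal.ofReal_natCast, ← ENNReal.ofReal_div_of_pos (by linarith)]
    refine ENNReal.ofReal_le_ofReal ?_
    rw [div_le_div_iff₀ (by positivity) (by linarith)]
    rw [le_div_iff₀ hη0] at hly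
    calc l j * n ≤ l j * η ^ (j + 1) := mul_le_mul_of_nonneg_left hj'.le (hl j).le
      _ = l j * η * η ^ j := by ring
      _ ≤ y * η ^ j := by gcongr
  calc ENNReal.ofReal (Real.exp x)
      = w j * ENNReal.ofReal (Real.exp (l j)) := by
        rw [← ENNReal.ofReal_mul (by positivity)]
        congr 1
        simp only [l, c]
        rw [Real.exp_add, Real.exp_add, Real.exp_log (by positivity), two_mul (Real.log _),
          Real.exp_add, Real.exp_log (by positivity)]
        field_simp
    _ ≤ w j * ENNReal.ofReal (Real.exp (n * (l j / η ^ j))) := by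
        gcongr
        rw [mul_div_assoc', le_div_iff₀ (by positivity), mul_comm (n : ℝ)]
        exact mul_le_mul_of_nonneg_left hj (hl j).le
    _ ≤ w j * g j n s := by gcongr; exact hgL j n s hn hlevel
    _ ≤ ∑' j, w j * g j n s := ENNReal.le_tsum (f := fun j => w j * g j n s) j

/-! ### From tail bounds to exponential moments -/

/-- From the deviation test functions, a test function that dominates the exponential of
`r` times the deviation. -/
lemma exists_testFun_exp_mul {ν : Measure ℝ} [IsProbabilityMeasure ν] {r : ℝ} (hr0 : 0 ≤ r)
    (hr1 : r < 1) {R : ℕ → ℝ → ℝ → Prop}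
    (h : ∀ x, 0 ≤ x → ∃ g, IsTestFun ν 1 g ∧ ∀ n s G, R n s G → x ≤ G →
      ENNReal.ofReal (Real.exp x) ≤ g n s) :
    ∃ g, IsTestFun ν (ENNReal.ofReal (1 / (1 - r))) g ∧ (∀ n s, 1 ≤ g n s) ∧
      ∀ n s G, R n s G → ENNReal.ofReal (Real.exp (r * G)) ≤ g n s := by
  let ε : ℕ → ℝ := fun m => 1 / ((m : ℝ) + 1)
  have hε0 : ∀ m, 0 < ε m := fun m => by positivity
  have hεlim : Tendsto ε atTop (𝓝 0) := tendsto_one_div_add_atTop_nhds_zero_nat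
  choose g hg hgx using fun m j : ℕ => h (ε m * (j + 1)) (by have := hε0 m; positivity)
  -- Increments of `x ↦ exp (r x)` on a grid of mesh `ε m`. Each is weighted by `exp (-x)` at its
  -- right end, because the test function of level `x` reaches `exp x`.
  let inc : ℕ → ℕ → ℝ := fun m j => Real.exp (r * (ε m * (j + 1))) - Real.exp (r * (ε m * j))
  have hinc : ∀ m j, 0 ≤ inc m j := fun m j => by
    have := hε0 m
    refine sub_nonneg.2 (Real.exp_le_exp.2 ?_)
    gcongr
    linarith
  let a : ℕ → ℕ → ℝ := fun m j => inc m j * Real.exp (-(ε m * (j + 1)))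
  have ha : ∀ m j, 0 ≤ a m j := fun m j => mul_nonneg (hinc m j) (Real.exp_pos _).le
  have hsum : ∀ m, 1 + ∑' j, ENNReal.ofReal (a m j) * 1 ≤ ENNReal.ofReal (1 / (1 - r)) := by
    intro m
    have he := hε0 m
    set q := Real.exp (-((1 - r) * ε m)) with hq
    have hqlt : q < 1 := by
      simpa [hq] using mul_pos (sub_pos.2 hr1) he
    have hform : ∀ j : ℕ, a m j = (1 - Real.exp (-(r * ε m))) * q * q ^ j := fun j => by
      simp only [a, inc, hq]
      rw [← Real.exp_nat_mul, sub_mul, sub_mul, sub_mul, one_mul, ← Real.exp_add, ← Real.exp_add,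
        ← Real.exp_add, ← Real.exp_add, ← Real.exp_add]
      ring_nf
    have hs : HasSum (a m) ((1 - Real.exp (-(r * ε m))) * q * (1 - q)⁻¹) := by
      rw [show a m = fun j => (1 - Real.exp (-(r * ε m))) * q * q ^ j from funext hform]
      exact (hasSum_geometric_of_lt_one (Real.exp_pos _).le hqlt).mul_left _
    simp only [mul_one]
    rw [← ENNReal.ofReal_tsum_of_nonneg (ha m) hs.summable, hs.tsum_eq, ← ENNReal.ofReal_one,
      ← ENNReal.ofReal_add zero_le_one (hs.tsum_eq ▸ tsum_nonneg (ha m))]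
    refine ENNReal.ofReal_le_ofReal ?_
    have h1 : 1 - Real.exp (-(r * ε m)) ≤ r * ε m := by
      linarith [Real.add_one_le_exp (-(r * ε m))]
    have h2 : (1 - r) * ε m * q ≤ 1 - q := by
      have h3 : q * Real.exp ((1 - r) * ε m) = 1 := by rw [hq, ← Real.exp_add]; simp
      nlinarith [Real.add_one_le_exp ((1 - r) * ε m), Real.exp_pos (-((1 - r) * ε m))]
    have h1r : 0 < 1 - r := by linarith
    have h4 : (1 - Real.exp (-(r * ε m))) * q * (1 - q)⁻¹ ≤ r / (1 - r) := by
      rw [← div_eq_mul_inv, div_le_div_iff₀ (by linarith) h1r]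
      have hqp : 0 < q := Real.exp_pos _
      calc (1 - Real.exp (-(r * ε m))) * q * (1 - r)
          ≤ r * ε m * q * (1 - r) := by gcongr
        _ = r * ((1 - r) * ε m * q) := by ring
        _ ≤ r * (1 - q) := by gcongr
    calc 1 + _ ≤ 1 + r / (1 - r) := by gcongr
      _ = 1 / (1 - r) := by field_simp; ring
  let φ : ℕ → ℕ → ℝ → ℝ≥0∞ := fun m n s => 1 + ∑' j, ENNReal.ofReal (a m j) * g m j n s
  have hφ : ∀ m, IsTestFun ν (ENNReal.ofReal (1 / (1 - r))) (φ m) := fun m =>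
    ((IsTestFun.const 1).add (IsTestFun.tsum_mul (hg m))).mono (hsum m)
  have hφ1 : ∀ m n s, 1 ≤ φ m n s := fun m n s => le_self_add
  refine ⟨_, IsTestFun.liminf hφ, fun n s => ?_, fun n s G hG => ?_⟩
  · exact le_liminf_of_le (by isBoundedDefault) (Eventually.of_forall fun m => hφ1 m n s)
  · have hbound : ∀ m, ENNReal.ofReal (Real.exp (r * (G - ε m))) ≤ φ m n s := by
      intro m
      have he := hε0 m
      rcases le_or_gt G 0 with hG0 | hG0
      · refine le_trans ?_ (hφ1 m n s)
        rw [← ENNReal.ofReal_one]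
        refine ENNReal.ofReal_le_ofReal (Real.exp_le_one_iff.2 ?_)
        exact mul_nonpos_of_nonneg_of_nonpos hr0 (by linarith)
      · set J := ⌊G / ε m⌋₊ with hJ
        have hJle : ε m * J ≤ G := by
          have := Nat.floor_le (div_nonneg hG0.le he.le)
          rwa [le_div_iff₀ he, mul_comm] at this
        have hJlt : G - ε m ≤ ε m * J := by
          have := Nat.lt_floor_add_one (G / ε m)
          rw [div_lt_iff₀ he] at this
          linarith
        have hterm : ∀ j ∈ Finset.range J, ENNReal.ofReal (inc m j) ≤
            ENNReal.ofReal (a m j) * g m j n s := by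
          intro j hj
          have hj1 : (j : ℝ) + 1 ≤ J := by exact_mod_cast Finset.mem_range.1 hj
          have := hgx m j n s G hG ((mul_le_mul_of_nonneg_left hj1 he.le).trans hJle)
          refine le_trans (le_of_eq ?_) (mul_le_mul_right this _)
          rw [← ENNReal.ofReal_mul (ha m j)]
          congr 1
          simp only [a]
          rw [mul_assoc, ← Real.exp_add]
          simp
        have htel : ∑ j ∈ Finset.range J, inc m j = Real.exp (r * (ε m * J)) - 1 := by
          have := Finset.sum_range_sub (fun j : ℕ => Real.exp (r * (ε m * j))) J
          simpa [inc] using this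
        calc ENNReal.ofReal (Real.exp (r * (G - ε m)))
            ≤ ENNReal.ofReal (1 + ∑ j ∈ Finset.range J, inc m j) := by
              rw [htel]
              refine ENNReal.ofReal_le_ofReal ?_
              rw [add_sub_cancel]
              exact Real.exp_le_exp.2 (mul_le_mul_of_nonneg_left hJlt hr0)
          _ = 1 + ∑ j ∈ Finset.range J, ENNReal.ofReal (inc m j) := by
              rw [ENNReal.ofReal_add zero_le_one (Finset.sum_nonneg fun j _ => hinc m j),
                ENNReal.ofReal_one, ENNReal.ofReal_sum_of_nonneg fun j _ => hinc m j]
          _ ≤ 1 + ∑ j ∈ Finset.range J, ENNReal.ofReal (a m j) * g m j n s := by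
              gcongr with j hj
              exact hterm j hj
          _ ≤ φ m n s := by
              simp only [φ]
              gcongr
              exact ENNReal.sum_le_tsum (f := fun j => ENNReal.ofReal (a m j) * g m j n s) _
    have hlim : Tendsto (fun m => ENNReal.ofReal (Real.exp (r * (G - ε m)))) atTop
        (𝓝 (ENNReal.ofReal (Real.exp (r * G)))) := by
      have := (hεlim.const_sub G).const_mul r
      rw [sub_zero] at this
      exact ENNReal.tendsto_ofReal ((Real.continuous_exp.tendsto _).comp this)
    rw [← hlim.liminf_eq]
    exact liminf_le_liminf (Eventually.of_forall hbound)

/-! ### The functions `h`, `hInv` and `hTilde` -/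

lemma h_strictMonoOn : StrictMonoOn h (Ici 1) := by
  intro u hu v _ huv
  have hu1 : (1 : ℝ) ≤ u := hu
  have hu0 : 0 < u := by linarith
  have hv0 : 0 < v := by linarith
  have h1 := Real.log_lt_sub_one_of_pos (div_pos hv0 hu0) (by
    rw [Ne, div_eq_one_iff_eq hu0.ne']; exact huv.ne')
  rw [Real.log_div hv0.ne' hu0.ne'] at h1
  have h2 : v / u - 1 ≤ v - u := by
    rw [div_sub_one hu0.ne', div_le_iff₀ hu0]
    nlinarith
  unfold h
  linarith

lemma h_one : h 1 = 1 := by simp [h]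

lemma one_le_h {u : ℝ} (hu : 1 ≤ u) : 1 ≤ h u :=
  h_one ▸ h_strictMonoOn.monotoneOn (mem_Ici.2 le_rfl) hu hu

lemma exists_h_eq {x : ℝ} (hx : 1 ≤ x) : ∃ u ∈ Ici (1 : ℝ), h u = x := by
  have hle : (1 : ℝ) ≤ Real.exp (2 * x) := Real.one_le_exp (by linarith)
  have hc : ContinuousOn h (Icc 1 (Real.exp (2 * x))) :=
    continuousOn_id.sub (Real.continuousOn_log.mono fun u hu => by
      have : (1 : ℝ) ≤ u := hu.1
      simp only [mem_compl_iff, mem_singleton_iff]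
      linarith)
  have hmem : x ∈ Icc (h 1) (h (Real.exp (2 * x))) := by
    refine ⟨h_one.symm ▸ hx, ?_⟩
    have := Real.quadratic_le_exp_of_nonneg (x := 2 * x) (by linarith)
    simp only [h, Real.log_exp]
    nlinarith
  obtain ⟨u, hu, hux⟩ := intermediate_value_Icc hle hc hmem
  exact ⟨u, hu.1, hux⟩

lemma one_le_hInv {x : ℝ} (hx : 1 ≤ x) : 1 ≤ hInv x := Function.invFunOn_mem (exists_h_eq hx)

lemma h_hInv {x : ℝ} (hx : 1 ≤ x) : h (hInv x) = x := Function.invFunOn_eq (exists_h_eq hx)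

/-- The variational form of `h̃_z`: it is attained by a ratio `η ∈ (1, z]`. -/
lemma exists_hTilde_eq {z : ℝ} (hz : 1 < z) (hz' : Real.log z ≤ 1) (y : ℝ) :
    ∃ η, 1 < η ∧ η ≤ z ∧ hTilde z y = η * (y - Real.log (Real.log η)) := by
  have hlog : 0 < Real.log z := Real.log_pos hz
  have h1z : 1 ≤ 1 / Real.log z := by rwa [one_le_div hlog]
  unfold hTilde
  split_ifs with hy
  · have hy1 : 1 ≤ y := (one_le_h h1z).trans hy
    have hq1 := one_le_hInv hy1
    have hq := h_hInv hy1
    set q := hInv y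
    have hzq : 1 / Real.log z ≤ q :=
      (h_strictMonoOn.le_iff_le h1z hq1).1 (hq.symm ▸ hy)
    -- With `ln η = 1/q`, the factor `y - ln ln η` is `h q + ln q = q`.
    refine ⟨Real.exp (1 / q), Real.one_lt_exp_iff.2 (by positivity), ?_, ?_⟩
    · rw [← Real.le_log_iff_exp_le (by linarith)]
      exact (one_div_le hlog (by linarith)).1 hzq
    · rw [Real.log_exp, one_div, Real.log_inv, ← hq]
      simp [h]
  · exact ⟨z, hz, le_rfl, rfl⟩

/-! ### Deviations of one arm, then of all arms together -/

/-- A test function for one arm, for observations of law `ν^μ`. -/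
lemma ExpFamily.exists_testFun (F : ExpFamily) {μ : ℝ} (hμ : μ ∈ F.means) {η : ℝ}
    (hη : 1 < η) (hη' : η ≤ 3 / 2) {r : ℝ} (hr0 : 0 ≤ r) (hr1 : r < 1) :
    ∃ g, IsTestFun (F.law μ) (ENNReal.ofReal (1 / (1 - r))) g ∧
      ∀ (n : ℕ) (s y : ℝ), ENNReal.ofReal y ≤ n * F.d (s / n) μ ∨ n = 0 ∧ y ≤ 0 →
        ENNReal.ofReal (Real.exp (r * ((y - 3 * Real.log (1 + Real.log n)) / η -
          Real.log (2 * (riemannZeta 2).re) + 2 * Real.log (Real.log η)))) ≤ g n s := by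
  have := F.isProbabilityMeasure_law hμ
  set T : Set (ℝ × ℝ) :=
    (fun θ => (θ - F.natParam μ, F.b θ - F.b (F.natParam μ))) '' F.Θ with hT
  have hν : ∀ p ∈ T, ∫⁻ x, ENNReal.ofReal (Real.exp (p.1 * x - p.2)) ∂(F.law μ) ≤ 1 := by
    rintro _ ⟨θ, hθ, rfl⟩
    exact (F.lintegral_likelihoodRatio (F.natParam μ) hθ).le
  have hd : ∀ x, F.d x μ ≤ ⨆ p ∈ T, ENNReal.ofReal (p.1 * x - p.2) := fun x => by
    rw [hT, iSup_image]
    exact F.d_le_iSup x hμ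
  set G : ℕ → ℝ → ℝ := fun n y => (y - 3 * Real.log (1 + Real.log n)) / η -
    Real.log (2 * (riemannZeta 2).re) + 2 * Real.log (Real.log η)
  obtain ⟨g, hg, hg1, hgG⟩ := exists_testFun_exp_mul (ν := F.law μ) hr0 hr1
    -- A real `y` below the evidence replaces the evidence itself, which may be infinite.
    (R := fun n s v => n ≠ 0 ∧ ∃ y, ENNReal.ofReal y ≤ n * F.d (s / n) μ ∧ v = G n y)
    (fun x hx => by
      obtain ⟨g, hg, hgx⟩ := exists_testFun_stitched hν hη hη' hx
      refine ⟨g, hg, ?_⟩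
      rintro n s _ ⟨hn, y, hy, rfl⟩ hxy
      exact hgx n s y hn (hy.trans (by gcongr; exact hd _)) hxy)
  refine ⟨g, hg, fun n s y hy => ?_⟩
  -- For an arm not yet drawn, the exponent is nonpositive (`Real.log 0 = 0` removes the penalty)
  -- and the bound `1 ≤ g` suffices.
  by_cases hn : n = 0
  · refine le_trans ?_ (hg1 n s)
    have hy0 : y ≤ 0 := by
      rcases hy with hy | hy
      · simpa [hn] using hy
      · exact hy.2
    rw [← ENNReal.ofReal_one]
    refine ENNReal.ofReal_le_ofReal (Real.exp_le_one_iff.2 (mul_nonpos_of_nonneg_of_nonpos hr0 ?_))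
    have h1 : Real.log (Real.log η) ≤ 0 := Real.log_nonpos (Real.log_pos hη).le
      (by linarith [Real.log_le_sub_one_of_pos (show 0 < η by linarith)])
    have h2 := log_two_mul_zeta_two_pos
    have h3 : y / η ≤ 0 := div_nonpos_of_nonpos_of_nonneg hy0 (by linarith)
    simp only [hn, Nat.cast_zero, Real.log_zero, add_zero, Real.log_one, mul_zero, sub_zero]
    linarith
  · exact hgG n s _ ⟨hn, y, hy.resolve_right fun h => hn h.1, rfl⟩

/-- A finite sum of extended nonnegative reals above a real level is bounded below, term by term,
by reals whose sum is at least that level. -/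
lemma exists_real_le_of_lt_sum {ι : Type*} [Fintype ι] {e : ι → ℝ≥0∞} {c : ℝ}
    (h : ((c : ℝ) : EReal) < ((∑ i, e i : ℝ≥0∞) : EReal)) :
    ∃ y : ι → ℝ, (∀ i, ENNReal.ofReal (y i) ≤ e i) ∧ c ≤ ∑ i, y i := by
  classical
  by_cases htop : ∃ i, e i = ∞
  · obtain ⟨i, hi⟩ := htop
    -- An infinite term can carry the whole level.
    refine ⟨fun j => if j = i then c else 0, fun j => ?_, by simp⟩
    by_cases hj : j = i
    · simp [hj, hi]
    · simp [hj]
  · push Not at htop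
    refine ⟨fun i => (e i).toReal, fun i => ENNReal.ofReal_toReal_le, ?_⟩
    rw [← ENNReal.toReal_sum fun i _ => htop i]
    have hfin : ∑ i, e i ≠ ∞ := by simpa [ENNReal.sum_eq_top] using htop
    rw [← EReal.coe_ennreal_toReal hfin] at h
    exact_mod_cast h.le

section Main

variable {K : ℕ} {Ω : Type*} [MeasurableSpace Ω] {P : Measure Ω} [IsProbabilityMeasure P]
  {F : ExpFamily} {μ : Fin K → ℝ} {U : ℕ → Ω → ℝ} {A : ℕ → Ω → Fin K} {X : ℕ → Ω → ℝ}

/-- The evidence against the true vector of means exceeds the threshold at some time with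
probability at most `δ`. -/
lemma measure_exists_threshold_lt_evidence_le (hμ : μ ∈ F.meanVectors K)
    (hrun : IsBanditRun P (fun a => F.law (μ a)) U A X) (init : Fin K → ℝ) {δ : ℝ} (hδ : 0 < δ)
    (hδ1 : δ ≤ 1) :
    P {ω | ∃ t, ((threshold A δ t ω : ℝ) : EReal) < (evidence F init A X t ω μ : EReal)} ≤
      ENNReal.ofReal δ := by
  rcases Nat.eq_zero_or_pos K with hK | hK
  · subst hK
    simp [threshold, evidence]
  have hK0 : (0 : ℝ) < K := by exact_mod_cast hK
  have hx0 : 0 ≤ Real.log (1 / δ) / K :=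
    div_nonneg (Real.log_nonneg (by rwa [one_le_div hδ])) hK0.le
  set x := Real.log (1 / δ) / K with hx
  have hv1 := one_le_hInv (x := 1 + x) (by linarith)
  have hv := h_hInv (x := 1 + x) (by linarith)
  set v := hInv (1 + x) with hvdef
  have hv0 : 0 < v := by linarith
  set c := Real.log (2 * (riemannZeta 2).re) with hc
  obtain ⟨η, hη, hη', hηeq⟩ := exists_hTilde_eq (z := 3 / 2) (by norm_num)
    (by linarith [Real.log_le_sub_one_of_pos (show (0 : ℝ) < 3 / 2 by norm_num)]) ((v + c) / 2)
  have hη0 : 0 < η := by linarith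
  have hT : threshT x = η * (v + c - 2 * Real.log (Real.log η)) := by
    rw [threshT, ← hvdef, ← hc, hηeq]
    ring
  -- The minimizer of `e^(-rv) / (1-r)`.
  set r := 1 - 1 / v with hr
  have hr0 : 0 ≤ r := sub_nonneg.2 ((div_le_one hv0).2 hv1)
  have hr1 : r < 1 := by
    have : 0 < 1 / v := by positivity
    linarith
  have hprob : ∀ a, IsProbabilityMeasure (F.law (μ a)) := fun a =>
    F.isProbabilityMeasure_law (hμ a)
  choose g hg hgG using fun a => F.exists_testFun (hμ a) hη hη' hr0 hr1
  have hville := hrun.ville hg (ENNReal.ofReal (Real.exp (r * (K * v))))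
  have hsub : {ω | ∃ t, ((threshold A δ t ω : ℝ) : EReal) < (evidence F init A X t ω μ : EReal)} ⊆
      {ω | ∃ t, ENNReal.ofReal (Real.exp (r * (K * v))) ≤
        ∏ a, g a (pulls A a t ω) (total A X a t ω)} := by
    rintro ω ⟨t, ht⟩
    refine ⟨t, ?_⟩
    obtain ⟨y, hy, hsum⟩ := exists_real_le_of_lt_sum ht
    have hga : ∀ a, _ ≤ g a (pulls A a t ω) (total A X a t ω) := fun a =>
      hgG a (pulls A a t ω) (total A X a t ω) (y a) (by
        by_cases hn : pulls A a t ω = 0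
        · exact Or.inr ⟨hn, by simpa [hn] using hy a⟩
        · left
          simpa [empMean, hn] using hy a)
    refine le_trans ?_ (Finset.prod_le_prod' fun a _ => hga a)
    rw [← ENNReal.ofReal_prod_of_nonneg fun a _ => (Real.exp_pos _).le, ← Real.exp_sum]
    refine ENNReal.ofReal_le_ofReal (Real.exp_le_exp.2 ?_)
    rw [← Finset.mul_sum]
    refine mul_le_mul_of_nonneg_left ?_ hr0
    have hthr : threshold A δ t ω = ∑ a, 3 * Real.log (1 + Real.log (pulls A a t ω)) +
        K * threshT x := by
      rw [threshold, Finset.mul_sum]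
      congr 1
      refine Finset.sum_congr rfl fun a _ => ?_
      split_ifs with hn <;> simp [hn]
    rw [hthr, hT] at hsum
    rw [Finset.sum_add_distrib, Finset.sum_sub_distrib, ← Finset.sum_div, Finset.sum_sub_distrib]
    simp only [Finset.sum_const, Finset.card_univ, Fintype.card_fin, nsmul_eq_mul]
    have h1 : K * (v + c - 2 * Real.log (Real.log η)) ≤
        (∑ a, y a - ∑ a, 3 * Real.log (1 + Real.log (pulls A a t ω))) / η := by
      rw [le_div_iff₀ hη0]
      linarith
    linarith
  have hle : ENNReal.ofReal (Real.exp (r * (K * v))) *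
      P {ω | ∃ t, ((threshold A δ t ω : ℝ) : EReal) < (evidence F init A X t ω μ : EReal)} ≤
      ENNReal.ofReal (v ^ K) := by
    refine (mul_le_mul_right (measure_mono hsub) _).trans (hville.trans (le_of_eq ?_))
    rw [Finset.prod_const, Finset.card_univ, Fintype.card_fin,
      ← ENNReal.ofReal_pow (by rw [hr]; simp [hv0.le])]
    congr 2
    rw [hr]
    simp
  have hδeq : v ^ K = Real.exp (r * (K * v)) * δ := by
    have hlogδ : Real.log δ = -(K * x) := by
      rw [hx, one_div, Real.log_inv]
      field_simp
    rw [← Real.exp_log hv0, ← Real.exp_nat_mul, Real.exp_log hv0]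
    conv_rhs => rw [← Real.exp_log hδ]
    rw [← Real.exp_add, hlogδ]
    congr 1
    have h1 : v - Real.log v = 1 + x := hv
    have h2 : r * (K * v) = K * (v - 1) := by rw [hr]; field_simp
    rw [h2]
    linear_combination (-(K : ℝ)) * h1
  rw [hδeq, ENNReal.ofReal_mul (Real.exp_pos _).le] at hle
  exact (ENNReal.mul_le_mul_iff_right (by simpa using Real.exp_pos _)
    ENNReal.ofReal_ne_top).1 hle

end Main

/-! ### The stopping rule and the conclusion -/

lemma index_eq_some {K M : ℕ} {F : ExpFamily} {O : Fin M → Set (Fin K → ℝ)}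
    (hO : IsIdentificationProblem F O) {i : Fin M} {x : Fin K → ℝ} (hx : x ∈ O i) :
    index O x = some i := by
  have hex : ∃ i, x ∈ O i := ⟨i, hx⟩
  rw [index, dif_pos hex]
  congr 1
  by_contra hne
  exact Set.disjoint_left.1 (hO.disjoint _ _ hne) hex.choose_spec hx

lemma threshold_lt_glr_of_glrStop_eq {K M : ℕ} {Ω : Type*} {F : ExpFamily}
    {O : Fin M → Set (Fin K → ℝ)} {init : Fin K → ℝ} {A : ℕ → Ω → Fin K} {X : ℕ → Ω → ℝ} {δ : ℝ}
    {ω : Ω} {t : ℕ} (ht : glrStop F O init A X δ ω = t) :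
    ((threshold A δ t ω : ℝ) : EReal) < (glr F O init A X t ω : EReal) := by
  -- The strict bound `t + 1` produces an actual stopping index `s ≤ t`, so the infimum is attained.
  have hlt : glrStop F O init A X δ ω < ((t + 1 : ℕ) : ℕ∞) := by
    rw [ht]
    exact_mod_cast t.lt_succ_self
  simp only [glrStop, iInf_lt_iff] at hlt
  obtain ⟨s, hs, hst⟩ := hlt
  have hst' : s ≤ t := Nat.lt_succ_iff.1 (by exact_mod_cast hst)
  have hts : (t : ℕ∞) ≤ s := ht ▸ iInf₂_le s hs
  have : s = t := le_antisymm hst' (by exact_mod_cast hts)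
  exact this ▸ hs

end SeqTest

theorem proposition5p1 {K M : ℕ} (F : SeqTest.ExpFamily)
    {Ω : Type*} [MeasurableSpace Ω] (P : Measure Ω) [IsProbabilityMeasure P]
    (μ : Fin K → ℝ) (hμ : μ ∈ F.meanVectors K)
    (U : ℕ → Ω → ℝ) (A : ℕ → Ω → Fin K) (X : ℕ → Ω → ℝ)
    (hrun : SeqTest.IsBanditRun P (fun a => F.law (μ a)) U A X)
    (init : Fin K → ℝ) (δ : ℝ) (hδ : 0 < δ) (hδ1 : δ ≤ 1) :
    ENNReal.ofReal (1 - δ) ≤ P {ω | ∀ t : ℕ, μ ∈ SeqTest.region F init A X δ t ω} ∧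
    ∀ O : Fin M → Set (Fin K → ℝ), SeqTest.IsIdentificationProblem F O →
      ∀ iStar : Fin M, μ ∈ O iStar →
        P {ω | ∃ t : ℕ, SeqTest.glrStop F O init A X δ ω = (t : ℕ∞) ∧
          SeqTest.index O (SeqTest.empMean init A X t ω) ≠ some iStar} ≤ ENNReal.ofReal δ := by
  have hbad := SeqTest.measure_exists_threshold_lt_evidence_le hμ hrun init hδ hδ1
  refine ⟨?_, fun O hO iStar hμO => (measure_mono ?_).trans hbad⟩
  · rw [ENNReal.ofReal_sub _ hδ.le, ENNReal.ofReal_one, tsub_le_iff_right]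
    -- Subadditivity over a cover, for which neither event has to be measurable.
    calc 1 = P univ := measure_univ.symm
      _ ≤ P ({ω | ∀ t : ℕ, μ ∈ SeqTest.region F init A X δ t ω} ∪
            {ω | ∃ t, ((SeqTest.threshold A δ t ω : ℝ) : EReal) <
              (SeqTest.evidence F init A X t ω μ : EReal)}) := by
          refine measure_mono fun ω _ => ?_
          by_cases hω : ∃ t, ((SeqTest.threshold A δ t ω : ℝ) : EReal) <
              (SeqTest.evidence F init A X t ω μ : EReal)
          · exact Or.inr hω
          · exact Or.inl fun t => ⟨hμ, not_lt.1 fun hlt => hω ⟨t, hlt⟩⟩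
      _ ≤ _ := (measure_union_le _ _).trans (by gcongr)
  · rintro ω ⟨t, ht, hidx⟩
    refine ⟨t, (SeqTest.threshold_lt_glr_of_glrStop_eq ht).trans_le ?_⟩
    have hAlt : μ ∈ SeqTest.Alt O (SeqTest.empMean init A X t ω) :=
      mem_iUnion₂.2 ⟨iStar, fun hmem => hidx (SeqTest.index_eq_some hO hmem), hμO⟩
    exact EReal.coe_ennreal_le_coe_ennreal_iff.2 (iInf₂_le μ hAlt)
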